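/- Let $X=(X,d,\mu)$ be a metric space with at least two points, equipped with a positive complete Borel measure $\mu$ (the completion of a measure on the Borel $\sigma$-algebra) such that $0<\mu(B)<\infty$ for all open balls $B=B(x,r)$, $x\in X$, $0<r<\infty$, and which is doubling: there is a constant $c_\mu>1$ with $\mu(B(x,2r))\le c_\mu\,\mu(B(x,r))$ for all $x\in X$ and $r>0$. A measurable function $g\colon X\to[0,\infty]$ is a Hajłasz $1$-gradient of $u\colon X\to\mathbb R$ if there is a set $N\subset X$ with $\mu(N)=0$ such that $|u(x)-u(y)|\le d(x,y)\,(g(x)+g(y))$ for all $x,y\in X\setminus N$. A curve is a nonconstant rectifiable continuous map from a compact interval to $X$, parametrized by arc length. For $1\le p<\infty$, a measurable function $g\colon X\to[0,\infty]$ is a $p$-weak upper gradient of $u\colon X\to\mathbb R$ if there is a Borel function $\rho\colon X\to[0,\infty]$ in $L^p_{\mathrm{loc}}(X)$ (every point has a ball centred at it on which $\int\rho^p\,d\mu<\infty$) such that $\int_\gamma\rho\,ds=\infty$ for every curve $\gamma$, with end points $x$ and $y$, for which the inequality $|u(x)-u(y)|\le\int_\gamma g\,ds$ fails. The space $X$ supports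 a $q$-Poincaré inequality with constants $C_P>0$ and $\lambda\ge1$ if $$\frac1{\mu(B)}\int_B|u-u_B|\,d\mu\le C_P\,\operatorname{diam}(B)\Bigl(\frac1{\mu(\lambda B)}\int_{\lambda B}g^q\,d\mu\Bigr)^{1/q},\qquad u_B=\frac1{\mu(B)}\int_B u\,d\mu,$$ for all balls $B=B(x,r)$, where $\lambda B=B(x,\lambda r)$, all measurable functions $u\colon X\to\mathbb R$ and all $q$-weak upper gradients $g$ of $u$; the left-hand side is interpreted as $\infty$ if $u_B$ is not defined. For a bounded open set $\Omega\subset X$ and a closed set $F\subset X$ with $F\subset\Omega$, set $$\operatorname{cap}_{1,p}(F,\Omega)=\inf_u\inf_g\int_X g^p\,d\mu,\qquad \operatorname{cap}_p(F,\Omega)=\inf_u\inf_g\int_\Omega g^p\,d\mu,$$ where in both cases $u$ ranges over all Lipschitz functions $u\colon X\to\mathbb R$ with $u\ge1$ in $F$ and $u=0$ in $X\setminus\Omega$, and $g$ ranges over all Hajłasz $1$-gradients of $u$ in the first case and over all $p$-weak upper gradients of $u$ in the second; the capacities equal $\infty$ if there are no such functions $u$. Let $1<p<\infty$. Then, for every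 bounded open set $\Omega\subset X$ and every closed set $F\subset\Omega$, $$\operatorname{cap}_p(F,\Omega)\le 4^p\,\operatorname{cap}_{1,p}(F,\Omega).$$ Moreover, if $X$ supports a $q$-Poincaré inequality for some $1\le q<p$, with constants $C_P$ and $\lambda\ge1$, then $$\operatorname{cap}_{1,p}(F,\Omega)\le C\,\operatorname{cap}_p(F,\Omega)$$ with a finite constant $C$ that depends only on $C_P$, $c_\mu$, $p$ and $q$ (and not on $X$, $\mu$, $\lambda$, $\Omega$ or $F$). -/

import Mathlib

open MeasureTheory Set Metric
open scoped ENNReal NNReal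

universe u

/-- The standing assumptions on a metric measure space: every ball has positive and finite measure,
and `μ` is doubling with doubling constant `cμ > 1`.

A complete Borel measure is represented by its restriction `μ` to the Borel `σ`-algebra; measurable
functions with respect to the completed `σ`-algebra are then exactly the functions that are
`AEMeasurable` with respect to `μ`, and null sets are the sets of outer measure zero. -/
structure IsDoublingMeasure {X : Type u} [MetricSpace X] [MeasurableSpace X]
    (μ : Measure X) (cμ : ℝ≥0) : Prop where
  ball_pos : ∀ (x : X) (r : ℝ), 0 < r → 0 < μ (ball x r)
  ball_lt_top : ∀ (x : X) (r : ℝ), 0 < r → μ (ball x r) < ∞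
  one_lt : 1 < cμ
  doubling : ∀ (x : X) (r : ℝ), 0 < r → μ (ball x (2 * r)) ≤ cμ * μ (ball x r)

/-! ### Hajłasz gradients and the variational Hajłasz capacity -/

/-- `g : X → [0,∞]` is a Hajłasz `β`-gradient of `u : X → ℝ`: it is measurable, and
`|u x - u y| ≤ d(x,y)^β (g x + g y)` for all `x`, `y` outside a set of measure zero. -/
def IsHajlaszGradient {X : Type u} [MetricSpace X] [MeasurableSpace X]
    (β : ℝ≥0) (μ : Measure X) (u : X → ℝ) (g : X → ℝ≥0∞) : Prop :=
  AEMeasurable g μ ∧ ∃ N : Set X, μ N = 0 ∧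
    ∀ x ∉ N, ∀ y ∉ N, edist (u x) (u y) ≤ edist x y ^ (β : ℝ) * (g x + g y)

/-- The test functions for the capacity of `F` relative to `Ω`: the `β`-Hölder functions `u` on `X`
(with some constant) such that `u ≥ 1` in `F` and `u = 0` in `X \ Ω`. -/
def IsCapacityTestFunction {X : Type u} [MetricSpace X]
    (β : ℝ≥0) (F Ω : Set X) (u : X → ℝ) : Prop :=
  (∃ κ : ℝ≥0, HolderWith κ β u) ∧ (∀ x ∈ F, 1 ≤ u x) ∧ ∀ x ∉ Ω, u x = 0

/-- The variational Hajłasz `(β,p)`-capacity of `F` relative to `Ω` (`∞` if there are no test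
functions). -/
noncomputable def hajlaszCapacity {X : Type u} [MetricSpace X] [MeasurableSpace X]
    (μ : Measure X) (β : ℝ≥0) (p : ℝ) (F Ω : Set X) : ℝ≥0∞ :=
  ⨅ (u : X → ℝ) (_ : IsCapacityTestFunction β F Ω u)
    (g : X → ℝ≥0∞) (_ : IsHajlaszGradient β μ u g), ∫⁻ x, g x ^ p ∂μ

/-! ### Weak upper gradients and the variational capacity -/

/-- A nonconstant rectifiable curve in `X`, parametrized by arc length on `[0, length]`.
(The values of `toFun` outside `[0, length]` are irrelevant.) -/
structure ArcLengthCurve (X : Type u) [MetricSpace X] where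
  length : ℝ
  length_pos : 0 < length
  toFun : ℝ → X
  unitSpeed : HasUnitSpeedOn toFun (Icc 0 length)

/-- The line integral `∫_γ g ds` of a nonnegative function. -/
noncomputable def ArcLengthCurve.lineIntegral {X : Type u} [MetricSpace X]
    (γ : ArcLengthCurve X) (g : X → ℝ≥0∞) : ℝ≥0∞ :=
  ∫⁻ t in Icc 0 γ.length, g (γ.toFun t)

/-- `g : X → [0,∞]` is a `p`-weak upper gradient of `u : X → ℝ`: it is measurable, and the
inequality `|u x - u y| ≤ ∫_γ g ds` holds for `p`-almost every curve `γ` joining points `x` and `y`,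
that is, there is a nonnegative Borel function `ρ` in `L^p_loc(X)` such that `∫_γ ρ ds = ∞` for each
curve `γ` for which the inequality fails.

(`g` agrees with a Borel function off a Borel null set `N`, and `∞ · χ_N` may be added to `ρ`; so
the curves on which `g` is not measurable never matter.) -/
def IsWeakUpperGradient {X : Type u} [MetricSpace X] [MeasurableSpace X]
    (p : ℝ) (μ : Measure X) (u : X → ℝ) (g : X → ℝ≥0∞) : Prop :=
  AEMeasurable g μ ∧ ∃ ρ : X → ℝ≥0∞, Measurable ρ ∧
    (∀ x : X, ∃ r : ℝ, 0 < r ∧ ∫⁻ y in ball x r, ρ y ^ p ∂μ < ∞) ∧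
    ∀ γ : ArcLengthCurve X,
      ¬ (edist (u (γ.toFun 0)) (u (γ.toFun γ.length)) ≤ γ.lineIntegral g) →
        γ.lineIntegral ρ = ∞

/-- The variational `p`-capacity of `F` relative to `Ω` (`∞` if there are no test functions); the
test functions are Lipschitz, that is, `1`-Hölder. -/
noncomputable def variationalCapacity {X : Type u} [MetricSpace X] [MeasurableSpace X]
    (μ : Measure X) (p : ℝ) (F Ω : Set X) : ℝ≥0∞ :=
  ⨅ (u : X → ℝ) (_ : IsCapacityTestFunction 1 F Ω u)
    (g : X → ℝ≥0∞) (_ : IsWeakUpperGradient p μ u g), ∫⁻ x in Ω, g x ^ p ∂μ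

/-- `X` supports a `q`-Poincaré inequality with constants `CP > 0` and `lam ≥ 1`: for all balls
`B = B(x,r)`, all measurable functions `u` on `X` and all `q`-weak upper gradients `g` of `u`,
`⨍_B |u - u_B| dμ ≤ CP diam(B) (⨍_{lam B} g^q dμ)^{1/q}`.

(If `u` is not integrable over `B`, then the left-hand side below equals `∞`, as it should: Mathlib
then puts `u_B = 0`, and the integral of `|u|` over `B` is `∞`.) -/
def SupportsPoincare {X : Type u} [MetricSpace X] [MeasurableSpace X]
    (μ : Measure X) (q : ℝ) (CP : ℝ≥0) (lam : ℝ) : Prop :=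
  0 < CP ∧ 1 ≤ lam ∧
    ∀ (x : X) (r : ℝ), 0 < r → ∀ u : X → ℝ, AEMeasurable u μ →
      ∀ g : X → ℝ≥0∞, IsWeakUpperGradient q μ u g →
        ⨍⁻ y in ball x r, edist (u y) (⨍ z in ball x r, u z ∂μ) ∂μ ≤
          CP * ENNReal.ofReal (diam (ball x r)) *
            (⨍⁻ y in ball x (lam * r), g y ^ q ∂μ) ^ (1 / q)

/-! Both capacities have the same test functions, so it suffices to convert, for a fixed Lipschitz
`u`, a gradient of one kind into a gradient of the other kind with control of its `L^p` norm.

From Hajłasz to upper gradients: almost every curve spends no length in the exceptional null set.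
Cut such a curve into short arcs of equal length, choose in each arc a point where `g` is at most
its average, and chain these points. This shows that `4 g` is a weak upper gradient
(`edist_le_four_mul_setLIntegral`), and `4 ^ p` follows.

Conversely, a `p`-weak upper gradient `g` may be set to `0` off `Ω` and is also a `q`-weak upper
gradient. The Poincaré inequality bounds the mean oscillation of `u` on `B(x,r)` by `r` times a
multiple of `(M g^q (x))^(1/q)`, where `M` is the maximal function, and telescoping over shrinking
balls turns this into a Hajłasz inequality (`SupportsPoincare.isHajlaszGradient`). Since `p / q >
1`, the maximal theorem on `L^(p/q)` bounds the `L^p` norm of this Hajłasz gradient by that of `g`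
(`lintegral_ballMaximalFunction_rpow_le`). The supremum in `M` runs over all radii, so the dilation
factor `lam` leaves no trace in the constant. -/

/-! ### The one-dimensional chaining estimate. -/

/-- A Lipschitz function on `[0, l]` that satisfies a Hajłasz type inequality with `h` off a null
set changes by at most `4 ∫ h`. -/
theorem edist_le_four_mul_setLIntegral {f : ℝ → ℝ} {h : ℝ → ℝ≥0∞} {L : ℝ≥0} {l : ℝ} (hl : 0 < l)
    (hf : LipschitzOnWith L f (Icc 0 l)) (hh : AEMeasurable h (volume.restrict (Icc 0 l)))
    {N : Set ℝ} (hN : volume (N ∩ Icc 0 l) = 0)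
    (hfh : ∀ s ∈ Icc 0 l \ N, ∀ t ∈ Icc 0 l \ N, edist (f s) (f t) ≤ edist s t * (h s + h t)) :
    edist (f 0) (f l) ≤ 4 * ∫⁻ t in Icc 0 l, h t := by
  -- The error term comes from the two end arcs, where only the Lipschitz bound is available; it
  -- vanishes as `n → ∞`.
  have main : ∀ n : ℕ, edist (f 0) (f l) ≤
      4 * (∫⁻ t in Icc 0 l, h t) + 2 * L * ENNReal.ofReal (l / (n + 1)) := by
    intro n
    set δ : ℝ := l / (n + 1) with hδdef
    have hδ : 0 < δ := by positivity
    have hnδ : (n + 1) * δ = l := by rw [hδdef]; field_simp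
    let I : ℕ → Set ℝ := fun i => Ioc (i * δ) ((i + 1) * δ)
    have hI : ∀ i ≤ n, I i ⊆ Icc 0 l := by
      rintro i hi t ⟨h1, h2⟩
      have : (i : ℝ) ≤ n := by exact_mod_cast hi
      refine ⟨le_trans (by positivity) h1.le, h2.trans ?_⟩
      rw [← hnδ]; gcongr
    have hvol : ∀ i, volume (I i) = ENNReal.ofReal δ := by
      intro i; simp only [I, Real.volume_Ioc]; congr 1; ring
    have hδ0 : ENNReal.ofReal δ ≠ 0 := by simpa using hδ
    have hex : ∀ i, ∃ s, i ≤ n → s ∈ I i ∧ s ∉ N ∧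
        ENNReal.ofReal δ * h s ≤ ∫⁻ t in I i, h t := by
      intro i
      by_cases hi : i ≤ n
      · have hμ : (volume.restrict (I i)) ≠ 0 := by
          rw [Ne, Measure.restrict_eq_zero, hvol]; exact hδ0
        have : IsFiniteMeasure (volume.restrict (I i)) := ⟨by
          rw [Measure.restrict_apply_univ, hvol]; exact ENNReal.ofReal_lt_top⟩
        -- Adding the complement of `I i` to the null set forces the chosen point to lie in `I i`.
        have hnull : volume.restrict (I i) (N ∪ (I i)ᶜ) = 0 := by
          refine measure_union_null ?_ ?_
          · rw [Measure.restrict_apply' measurableSet_Ioc]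
            exact measure_mono_null (inter_subset_inter_right _ (hI i hi)) hN
          · rw [Measure.restrict_apply' measurableSet_Ioc, compl_inter_self, measure_empty]
        obtain ⟨s, hs, hle⟩ := exists_notMem_null_le_laverage hμ
          (hh.mono_measure (Measure.restrict_mono (hI i hi) le_rfl)) hnull
        simp only [mem_union, mem_compl_iff, not_or, not_not] at hs
        refine ⟨s, fun _ => ⟨hs.2, hs.1, ?_⟩⟩
        rw [setLAverage_eq, hvol] at hle
        rw [mul_comm]
        exact (ENNReal.le_div_iff_mul_le (Or.inl hδ0) (Or.inl ENNReal.ofReal_ne_top)).1 hle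
      · exact ⟨0, fun h => absurd h hi⟩
    choose s hs using hex
    have hsI : ∀ i ≤ n, s i ∈ Icc 0 l := fun i hi => hI i hi (hs i hi).1
    -- Points of adjacent arcs are at most `2 δ` apart, and `δ * h (s i)` is at most the integral
    -- over `I i`. Each arc occurs in at most two steps, whence `2 + 2 = 4`.
    have hstep : ∀ i < n, edist (f (s i)) (f (s (i + 1))) ≤
        2 * (∫⁻ t in I i, h t) + 2 * ∫⁻ t in I (i + 1), h t := by
      intro i hi
      have h1 := hs i hi.le
      have h2 := hs (i + 1) hi
      have hd : edist (s i) (s (i + 1)) ≤ 2 * ENNReal.ofReal δ := by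
        rw [edist_dist, ← ENNReal.ofReal_ofNat, ← ENNReal.ofReal_mul (by norm_num)]
        apply ENNReal.ofReal_le_ofReal
        have a := h1.1; have b := h2.1
        simp only [I, mem_Ioc, Nat.cast_add, Nat.cast_one] at a b
        rw [Real.dist_eq, abs_le]; constructor <;> nlinarith
      calc _ ≤ edist (s i) (s (i + 1)) * (h (s i) + h (s (i + 1))) :=
            hfh _ ⟨hsI i hi.le, h1.2.1⟩ _ ⟨hsI _ hi, h2.2.1⟩
        _ ≤ 2 * ENNReal.ofReal δ * (h (s i) + h (s (i + 1))) := by gcongr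
        _ = 2 * (ENNReal.ofReal δ * h (s i)) + 2 * (ENNReal.ofReal δ * h (s (i + 1))) := by ring
        _ ≤ _ := by gcongr; exacts [h1.2.2, h2.2.2]
    have hsum : ∑ i ∈ Finset.range (n + 1), ∫⁻ t in I i, h t ≤ ∫⁻ t in Icc 0 l, h t := by
      rw [← lintegral_biUnion_finset _ (fun i _ => measurableSet_Ioc)]
      · apply lintegral_mono_set
        simp only [Finset.mem_range, iUnion_subset_iff]
        intro i hi; exact hI i (Nat.lt_succ_iff.1 hi)
      · intro i _ j _ hij
        have key : ∀ a b : ℕ, a < b → Disjoint (I a) (I b) := by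
          intro a b hab
          rw [Set.disjoint_left]
          rintro t ⟨_, h1⟩ ⟨h2, _⟩
          have : (a : ℝ) + 1 ≤ b := by exact_mod_cast hab
          nlinarith
        rcases lt_or_gt_of_ne hij with h1 | h1
        · exact key _ _ h1
        · exact (key _ _ h1).symm
    have hmid : edist (f (s 0)) (f (s n)) ≤ 4 * ∫⁻ t in Icc 0 l, h t := by
      calc edist (f (s 0)) (f (s n))
          ≤ ∑ i ∈ Finset.range n, edist (f (s i)) (f (s (i + 1))) :=
            edist_le_range_sum_edist (fun i => f (s i)) n
        _ ≤ ∑ i ∈ Finset.range n, (2 * (∫⁻ t in I i, h t) + 2 * ∫⁻ t in I (i + 1), h t) :=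
            Finset.sum_le_sum fun i hi => hstep i (Finset.mem_range.1 hi)
        _ = 2 * (∑ i ∈ Finset.range n, ∫⁻ t in I i, h t) +
            2 * ∑ i ∈ Finset.range n, ∫⁻ t in I (i + 1), h t := by
            rw [Finset.sum_add_distrib, Finset.mul_sum, Finset.mul_sum]
        _ ≤ 2 * (∫⁻ t in Icc 0 l, h t) + 2 * ∫⁻ t in Icc 0 l, h t := by
            gcongr
            · refine le_trans ?_ hsum
              rw [Finset.sum_range_succ]; exact le_self_add
            · refine le_trans ?_ hsum
              rw [Finset.sum_range_succ']; exact le_self_add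
        _ = _ := by ring
    have hend : ∀ a ∈ Icc 0 l, ∀ b ∈ Icc 0 l, |a - b| ≤ δ →
        edist (f a) (f b) ≤ L * ENNReal.ofReal δ := by
      intro a ha b hb hab
      refine (hf ha hb).trans ?_
      gcongr
      rw [edist_dist]; exact ENNReal.ofReal_le_ofReal hab
    have e1 : edist (f 0) (f (s 0)) ≤ L * ENNReal.ofReal δ := by
      refine hend _ ⟨le_rfl, hl.le⟩ _ (hsI 0 (Nat.zero_le _)) ?_
      have a := (hs 0 (Nat.zero_le _)).1
      simp only [I, mem_Ioc, Nat.cast_zero] at a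
      rw [abs_le]; constructor <;> linarith
    have e2 : edist (f (s n)) (f l) ≤ L * ENNReal.ofReal δ := by
      refine hend _ (hsI n le_rfl) _ ⟨hl.le, le_rfl⟩ ?_
      have a := (hs n le_rfl).1
      simp only [I, mem_Ioc] at a
      rw [abs_le]; constructor <;> linarith
    calc edist (f 0) (f l) ≤ edist (f 0) (f (s 0)) + edist (f (s 0)) (f (s n)) +
          edist (f (s n)) (f l) := edist_triangle4 _ _ _ _
      _ ≤ L * ENNReal.ofReal δ + 4 * (∫⁻ t in Icc 0 l, h t) + L * ENNReal.ofReal δ := by gcongr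
      _ = _ := by ring
  have hlim : Filter.Tendsto (fun n : ℕ => 4 * (∫⁻ t in Icc 0 l, h t) +
      2 * L * ENNReal.ofReal (l / (n + 1))) Filter.atTop
      (nhds (4 * (∫⁻ t in Icc 0 l, h t) + 2 * L * ENNReal.ofReal 0)) := by
    refine tendsto_const_nhds.add (ENNReal.Tendsto.const_mul ?_ (Or.inr ?_))
    · refine ENNReal.tendsto_ofReal ?_
      have := (tendsto_one_div_add_atTop_nhds_zero_nat (𝕜 := ℝ)).const_mul l
      simpa [div_eq_mul_inv] using this
    · exact ENNReal.mul_ne_top (by simp) ENNReal.coe_ne_top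
  simpa using ge_of_tendsto' hlim main

/-! ### Arc length curves and their subcurves. -/

namespace ArcLengthCurve

variable {X : Type u} [MetricSpace X]

theorem lipschitzOnWith (γ : ArcLengthCurve X) : LipschitzOnWith 1 γ.toFun (Icc 0 γ.length) := by
  have key : ∀ s ∈ Icc 0 γ.length, ∀ t ∈ Icc 0 γ.length, s ≤ t →
      edist (γ.toFun s) (γ.toFun t) ≤ edist s t := by
    intro s hs t ht hst
    have h1 := γ.unitSpeed hs ht
    have h2 := eVariationOn.edist_le γ.toFun (s := Icc 0 γ.length ∩ Icc s t)
      ⟨hs, left_mem_Icc.2 hst⟩ ⟨ht, right_mem_Icc.2 hst⟩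
    rw [h1] at h2
    refine h2.trans (le_of_eq ?_)
    rw [edist_dist, Real.dist_eq, abs_sub_comm, abs_of_nonneg (sub_nonneg.2 hst)]
    simp
  intro s hs t ht
  rw [ENNReal.coe_one, one_mul]
  rcases le_total s t with h | h
  · exact key s hs t ht h
  · rw [edist_comm, edist_comm s]; exact key t ht s hs h

/-- The restriction of a curve to `[a, b]`, translated to start at `0`. -/
def subcurve (γ : ArcLengthCurve X) (a b : ℝ) (ha : 0 ≤ a) (hab : a < b) (hb : b ≤ γ.length) :
    ArcLengthCurve X where
  length := b - a
  length_pos := sub_pos.2 hab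
  toFun t := γ.toFun (a + t)
  unitSpeed := by
    intro x hx y hy
    have hm : MonotoneOn (fun t : ℝ => a + t) (Icc 0 (b - a) ∩ Icc x y) :=
      fun s _ t _ h => by simpa using h
    have h := eVariationOn.comp_eq_of_monotoneOn γ.toFun _ hm
    have hset : (fun t : ℝ => a + t) '' (Icc 0 (b - a) ∩ Icc x y) =
        Icc 0 γ.length ∩ Icc (a + x) (a + y) := by
      simp only [mem_Icc] at hx hy
      ext t
      simp only [mem_image, mem_inter_iff, mem_Icc]
      constructor
      · rintro ⟨s, ⟨⟨_, _⟩, _, _⟩, rfl⟩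
        refine ⟨⟨?_, ?_⟩, ?_, ?_⟩ <;> linarith
      · rintro ⟨⟨_, _⟩, _, _⟩
        exact ⟨t - a, ⟨⟨by linarith, by linarith⟩, by linarith, by linarith⟩, by ring⟩
    have h' := γ.unitSpeed (x := a + x) ⟨by linarith [hx.1], by linarith [hx.2]⟩
      (y := a + y) ⟨by linarith [hy.1], by linarith [hy.2]⟩
    rw [← hset, ← h] at h'
    rw [add_sub_add_left_eq_sub] at h'
    exact h'

theorem lineIntegral_subcurve (γ : ArcLengthCurve X) {a b : ℝ} (ha : 0 ≤ a) (hab : a < b)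
    (hb : b ≤ γ.length) (g : X → ℝ≥0∞) :
    (γ.subcurve a b ha hab hb).lineIntegral g = ∫⁻ t in Icc a b, g (γ.toFun t) := by
  have h := (measurePreserving_add_left (volume : Measure ℝ) a).setLIntegral_comp_preimage_emb
    (measurableEmbedding_addLeft a) (fun t => g (γ.toFun t)) (Icc a b)
  have hset : (fun t : ℝ => a + t) ⁻¹' Icc a b = Icc 0 (b - a) := by
    ext t; simp only [mem_preimage, mem_Icc]; constructor <;> rintro ⟨_, _⟩ <;>
      constructor <;> linarith
  rw [hset] at h
  exact h

theorem lineIntegral_subcurve_le (γ : ArcLengthCurve X) {a b : ℝ} (ha : 0 ≤ a) (hab : a < b)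
    (hb : b ≤ γ.length) (g : X → ℝ≥0∞) :
    (γ.subcurve a b ha hab hb).lineIntegral g ≤ γ.lineIntegral g := by
  rw [lineIntegral_subcurve]
  exact lintegral_mono_set (Icc_subset_Icc ha hb)

end ArcLengthCurve

/-! ### Hajłasz gradients as weak upper gradients. -/

variable {X : Type u} [MetricSpace X] [MeasurableSpace X]

/-- A Hajłasz gradient of a Lipschitz function is, up to the factor `4`, a weak upper gradient. -/
theorem IsHajlaszGradient.isWeakUpperGradient [BorelSpace X] {μ : Measure X} {u : X → ℝ}
    {g : X → ℝ≥0∞} {L : ℝ≥0} (hu : LipschitzWith L u) (hg : IsHajlaszGradient 1 μ u g) {p : ℝ}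
    (hp : 0 < p) : IsWeakUpperGradient p μ u (fun x => 4 * g x) := by
  obtain ⟨hgm, N, hN, hug⟩ := hg
  refine ⟨hgm.const_mul 4, ?_⟩
  -- A Borel null set that contains both `N` and the points where `g` differs from its Borel
  -- representative; `∞ · χ_A` is the function that discards bad curves.
  set A : Set X := toMeasurable μ (N ∪ {x | g x ≠ hgm.mk g x}) with hA
  have hAm : MeasurableSet A := measurableSet_toMeasurable _ _
  have hA0 : μ A = 0 := by
    rw [hA, measure_toMeasurable]
    exact measure_union_null hN hgm.ae_eq_mk
  have hsub : ∀ x ∉ A, x ∉ N ∧ g x = hgm.mk g x := by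
    intro x hx
    have := fun h => hx (subset_toMeasurable μ (N ∪ {x | g x ≠ hgm.mk g x}) h)
    simpa [not_or] using this
  refine ⟨A.indicator fun _ => ∞, measurable_const.indicator hAm, fun x => ⟨1, one_pos, ?_⟩, ?_⟩
  · have : ∫⁻ y in ball x 1, (A.indicator (fun _ => ∞) y : ℝ≥0∞) ^ p ∂μ = 0 := by
      have h0 : (fun y => (A.indicator (fun _ => ∞) y : ℝ≥0∞) ^ p) =ᵐ[μ.restrict (ball x 1)] 0 := by
        refine ae_restrict_of_ae ?_
        filter_upwards [measure_eq_zero_iff_ae_notMem.1 hA0] with y hy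
        simp [hy, hp]
      rw [lintegral_congr_ae h0]; simp
    rw [this]; exact ENNReal.zero_lt_top
  · intro γ hγ
    by_contra hρ
    apply hγ
    have hcont := γ.lipschitzOnWith.continuousOn
    have hγm : AEMeasurable γ.toFun (volume.restrict (Icc 0 γ.length)) :=
      hcont.aemeasurable measurableSet_Icc
    -- A finite line integral of `∞ · χ_A` means that the curve meets `A` only in a set of
    -- parameters of measure zero.
    have hpre : volume (γ.toFun ⁻¹' A ∩ Icc 0 γ.length) = 0 := by
      have hm : AEMeasurable (fun t => (A.indicator (fun _ => ∞) (γ.toFun t) : ℝ≥0∞))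
          (volume.restrict (Icc 0 γ.length)) :=
        (measurable_const.indicator hAm).comp_aemeasurable hγm
      have := ae_lt_top' hm hρ
      rw [ae_iff, Measure.restrict_apply' measurableSet_Icc] at this
      refine measure_mono_null ?_ this
      rintro t ⟨h1, h2⟩
      refine ⟨?_, h2⟩
      have h1' : γ.toFun t ∈ A := h1
      simp [h1']
    have hae : ∀ᵐ t ∂(volume.restrict (Icc 0 γ.length)), γ.toFun t ∉ A := by
      rw [ae_iff, Measure.restrict_apply' measurableSet_Icc]
      simp only [not_not]; exact hpre
    have hgγ : AEMeasurable (fun t => g (γ.toFun t)) (volume.restrict (Icc 0 γ.length)) := by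
      refine (hgm.measurable_mk.comp_aemeasurable hγm).congr ?_
      filter_upwards [hae] with t ht
      exact (hsub _ ht).2.symm
    have key := edist_le_four_mul_setLIntegral (f := fun t => u (γ.toFun t)) γ.length_pos
      (hu.comp_lipschitzOnWith γ.lipschitzOnWith) hgγ hpre (by
        rintro s ⟨hs, hsA⟩ t ⟨ht, htA⟩
        have h1 := hug _ (hsub _ hsA).1 _ (hsub _ htA).1
        have h2 := γ.lipschitzOnWith hs ht
        simp only [NNReal.coe_one, ENNReal.rpow_one] at h1
        rw [ENNReal.coe_one, one_mul] at h2
        exact h1.trans (by gcongr))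
    refine key.trans (le_of_eq ?_)
    rw [ArcLengthCurve.lineIntegral, lintegral_const_mul'' _ hgγ]

theorem variationalCapacity_le_hajlaszCapacity [BorelSpace X] (μ : Measure X) {p : ℝ} (hp : 0 < p)
    (F Ω : Set X) : variationalCapacity μ p F Ω ≤ 4 ^ p * hajlaszCapacity μ 1 p F Ω := by
  have h0 : (4 : ℝ≥0∞) ^ p ≠ 0 := by simp [ENNReal.rpow_eq_zero_iff]
  have h1 : (4 : ℝ≥0∞) ^ p ≠ ∞ := by simp [ENNReal.rpow_eq_top_iff]
  rw [mul_comm, ← ENNReal.div_le_iff_le_mul (Or.inl h0) (Or.inl h1)]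
  refine le_iInf₂ fun u hu => le_iInf₂ fun g hg => ?_
  rw [ENNReal.div_le_iff_le_mul (Or.inl h0) (Or.inl h1)]
  obtain ⟨κ, hκ⟩ := hu.1
  refine (iInf₂_le_of_le u hu (iInf₂_le _
    (hg.isWeakUpperGradient (holderWith_one.1 hκ) hp))).trans ?_
  refine (setLIntegral_le_lintegral _ _).trans ?_
  rw [mul_comm, ← lintegral_const_mul' _ _ h1]
  refine lintegral_mono fun x => ?_
  rw [ENNReal.mul_rpow_of_nonneg _ _ hp.le]

/-! ### Changing the exponent and localizing weak upper gradients. -/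

/-- The same `ρ` serves: `ρ^q ≤ 1 + ρ^p`, and balls have finite measure. -/
theorem IsWeakUpperGradient.mono_exponent {μ : Measure X} {cμ : ℝ≥0} (hμ : IsDoublingMeasure μ cμ)
    {u : X → ℝ} {g : X → ℝ≥0∞} {p q : ℝ} (hq : 0 ≤ q) (hqp : q ≤ p)
    (hg : IsWeakUpperGradient p μ u g) : IsWeakUpperGradient q μ u g := by
  obtain ⟨hgm, ρ, hρ, hloc, hγ⟩ := hg
  refine ⟨hgm, ρ, hρ, fun x => ?_, hγ⟩
  obtain ⟨r, hr, hfin⟩ := hloc x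
  refine ⟨r, hr, ?_⟩
  calc ∫⁻ y in ball x r, ρ y ^ q ∂μ ≤ ∫⁻ y in ball x r, (1 + ρ y ^ p) ∂μ := by
        refine lintegral_mono fun y => ?_
        rcases le_total (ρ y) 1 with h | h
        · exact (ENNReal.rpow_le_one h hq).trans le_self_add
        · exact (ENNReal.rpow_le_rpow_of_exponent_le h hqp).trans le_add_self
    _ = μ (ball x r) + ∫⁻ y in ball x r, ρ y ^ p ∂μ := by
        rw [lintegral_add_left measurable_const]; simp
    _ < ∞ := ENNReal.add_lt_top.2 ⟨hμ.ball_lt_top x r hr, hfin⟩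

/-- If `u` vanishes off the open set `Ω`, then weak upper gradients of `u` may be replaced by `0`
off `Ω`. -/
theorem IsWeakUpperGradient.indicator [BorelSpace X] {μ : Measure X} {u : X → ℝ} {g : X → ℝ≥0∞}
    {p : ℝ} {Ω : Set X} (hΩ : IsOpen Ω) (hu : ∀ x ∉ Ω, u x = 0) (hg : IsWeakUpperGradient p μ u g) :
    IsWeakUpperGradient p μ u (Ω.indicator g) := by
  obtain ⟨hgm, ρ, hρ, hloc, hγ⟩ := hg
  refine ⟨hgm.indicator hΩ.measurableSet, ρ, hρ, hloc, fun γ hfail => ?_⟩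
  by_contra hfin
  apply hfail
  -- If `∫_γ ρ` is finite, it is finite on every subcurve, so none of the subcurves is exceptional.
  have hsubc : ∀ a b : ℝ, 0 ≤ a → a ≤ b → b ≤ γ.length →
      edist (u (γ.toFun a)) (u (γ.toFun b)) ≤ ∫⁻ t in Icc a b, g (γ.toFun t) := by
    intro a b ha hab hb
    rcases hab.eq_or_lt with rfl | hab
    · simp
    have h := not_imp_comm.1 (hγ (γ.subcurve a b ha hab hb))
      (fun h => hfin (top_le_iff.1 (h ▸ γ.lineIntegral_subcurve_le ha hab hb ρ)))
    rw [γ.lineIntegral_subcurve] at h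
    simpa [ArcLengthCurve.subcurve] using h
  have hcont := γ.lipschitzOnWith.continuousOn
  have h0l := γ.length_pos.le
  set K : Set ℝ := Icc 0 γ.length ∩ γ.toFun ⁻¹' Ωᶜ with hK
  have hKc : IsCompact K :=
    isCompact_Icc.of_isClosed_subset
      (hcont.preimage_isClosed_of_isClosed isClosed_Icc hΩ.isClosed_compl) inter_subset_left
  have hin : ∀ s : Set ℝ, MeasurableSet s → s ⊆ Icc 0 γ.length → Disjoint s K →
      ∫⁻ t in s, g (γ.toFun t) = ∫⁻ t in s, Ω.indicator g (γ.toFun t) := by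
    intro s hs hsI hsK
    refine setLIntegral_congr_fun hs fun t ht => ?_
    have : γ.toFun t ∈ Ω := by
      by_contra h; exact Set.disjoint_left.1 hsK ht ⟨hsI ht, h⟩
    simp [this]
  rcases K.eq_empty_or_nonempty with hKe | hKne
  · refine (hsubc 0 γ.length le_rfl h0l le_rfl).trans (le_of_eq ?_)
    exact hin _ measurableSet_Icc Subset.rfl (by simp [hKe])
  -- `a` and `b` are the first and last times off `Ω`. As `u` vanishes at both, only `[0, a]` and
  -- `[b, length]` contribute.
  · obtain ⟨a, ha⟩ := hKc.exists_isLeast hKne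
    obtain ⟨b, hb⟩ := hKc.exists_isGreatest hKne
    have hab : a ≤ b := ha.2 hb.1
    have hua : u (γ.toFun a) = 0 := hu _ ha.1.2
    have hub : u (γ.toFun b) = 0 := hu _ hb.1.2
    have h1 := hsubc 0 a le_rfl ha.1.1.1 ha.1.1.2
    have h2 := hsubc b γ.length hb.1.1.1 hb.1.1.2 le_rfl
    -- Half-open intervals omit the times `a` and `b`, at which the curve is outside `Ω`.
    rw [setLIntegral_congr Ico_ae_eq_Icc.symm, hin _ measurableSet_Ico
      (fun t ht => ⟨ht.1, ht.2.le.trans ha.1.1.2⟩)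
      (Set.disjoint_left.2 fun t ht hK => absurd (ha.2 hK) (not_le.2 ht.2))] at h1
    rw [setLIntegral_congr Ioc_ae_eq_Icc.symm, hin _ measurableSet_Ioc
      (fun t ht => ⟨hb.1.1.1.trans ht.1.le, ht.2⟩)
      (Set.disjoint_left.2 fun t ht hK => absurd (hb.2 hK) (not_le.2 ht.1))] at h2
    calc edist (u (γ.toFun 0)) (u (γ.toFun γ.length))
        ≤ edist (u (γ.toFun 0)) (u (γ.toFun a)) +
          edist (u (γ.toFun b)) (u (γ.toFun γ.length)) := by
          rw [hub, ← hua]; exact edist_triangle _ _ _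
      _ ≤ _ := add_le_add h1 h2
      _ = ∫⁻ t in Ico 0 a ∪ Ioc b γ.length, Ω.indicator g (γ.toFun t) := by
          rw [lintegral_union measurableSet_Ioc]
          exact Set.disjoint_left.2 fun t h h' => absurd (h.2.trans_le hab) (not_lt.2 h'.1.le)
      _ ≤ _ := by
          refine lintegral_mono_set (union_subset ?_ ?_)
          · exact fun t ht => ⟨ht.1, ht.2.le.trans ha.1.1.2⟩
          · exact fun t ht => ⟨hb.1.1.1.trans ht.1.le, ht.2⟩

/-! ### The maximal theorem in doubling spaces. -/

/-- The noncentered Hardy–Littlewood maximal function, over open balls. -/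
noncomputable def ballMaximalFunction (μ : Measure X) (f : X → ℝ≥0∞) (x : X) : ℝ≥0∞ :=
  ⨆ (z : X) (r : ℝ) (_ : 0 < r) (_ : x ∈ ball z r), ⨍⁻ y in ball z r, f y ∂μ

section MaximalFunction

variable {μ : Measure X} {cμ : ℝ≥0} {f : X → ℝ≥0∞}

theorem setLAverage_ball_le_ballMaximalFunction {x z : X} {r : ℝ} (hx : x ∈ ball z r) :
    ⨍⁻ y in ball z r, f y ∂μ ≤ ballMaximalFunction μ f x :=
  le_iSup_of_le z (le_iSup_of_le r (le_iSup_of_le (pos_of_mem_ball hx) (le_iSup_of_le hx le_rfl)))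

theorem lt_ballMaximalFunction_iff {x : X} {t : ℝ≥0∞} :
    t < ballMaximalFunction μ f x ↔
      ∃ z : X, ∃ r : ℝ, x ∈ ball z r ∧ t < ⨍⁻ y in ball z r, f y ∂μ := by
  simp only [ballMaximalFunction, lt_iSup_iff]
  exact ⟨fun ⟨z, r, _, h2, h3⟩ => ⟨z, r, h2, h3⟩, fun ⟨z, r, h2, h3⟩ =>
    ⟨z, r, pos_of_mem_ball h2, h2, h3⟩⟩

/-- Because the balls need not be centered at `x`, superlevel sets are unions of open balls, hence
open; no regularity of `f` is needed. -/
theorem measurable_ballMaximalFunction [BorelSpace X] : Measurable (ballMaximalFunction μ f) := by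
  refine measurable_of_Ioi fun t => IsOpen.measurableSet ?_
  have : ballMaximalFunction μ f ⁻¹' Ioi t =
      ⋃ (z : X) (r : ℝ) (_ : t < ⨍⁻ y in ball z r, f y ∂μ), ball z r := by
    ext x
    simp only [mem_preimage, mem_Ioi, lt_ballMaximalFunction_iff, mem_iUnion, exists_prop]
    simp only [and_comm]
  rw [this]
  exact isOpen_iUnion fun z => isOpen_iUnion fun r => isOpen_iUnion fun _ => isOpen_ball

theorem IsDoublingMeasure.measure_ball_two_pow_mul_le (hμ : IsDoublingMeasure μ cμ) (x : X) {r : ℝ}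
    (hr : 0 < r) (n : ℕ) : μ (ball x (2 ^ n * r)) ≤ cμ ^ n * μ (ball x r) := by
  induction n with
  | zero => simp
  | succ n ih =>
    rw [pow_succ', pow_succ', mul_assoc, mul_assoc]
    exact (hμ.doubling x _ (by positivity)).trans (by gcongr)

theorem IsDoublingMeasure.sigmaFinite (hμ : IsDoublingMeasure μ cμ) : SigmaFinite μ := by
  rcases isEmpty_or_nonempty X with h | ⟨⟨x⟩⟩
  · have : μ = 0 := Measure.eq_zero_of_isEmpty μ
    rw [this]; infer_instance
  · refine ⟨⟨⟨fun n => ball x (n + 1), fun _ => trivial,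
      fun n => hμ.ball_lt_top x _ (by positivity), ?_⟩⟩⟩
    refine eq_univ_of_forall fun y => mem_iUnion.2 ?_
    obtain ⟨n, hn⟩ := exists_nat_gt (dist y x)
    exact ⟨n, by rw [mem_ball]; linarith⟩

/-- The weak type `(1, 1)` estimate for the maximal function. -/
theorem mul_measure_lt_ballMaximalFunction_le [BorelSpace X] (hμ : IsDoublingMeasure μ cμ)
    (t : ℝ≥0∞) : t * μ {x | t < ballMaximalFunction μ f x} ≤ cμ ^ 3 * ∫⁻ x, f x ∂μ := by
  have := hμ.sigmaFinite
  -- Radii are bounded by `n` because the Vitali covering argument needs bounded radii; the sets `U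
  -- n` increase to the superlevel set.
  let T : ℕ → Set (X × ℝ) := fun n => {a | 0 < a.2 ∧ a.2 ≤ n ∧ t < ⨍⁻ y in ball a.1 a.2, f y ∂μ}
  let U : ℕ → Set X := fun n => ⋃ a ∈ T n, ball a.1 a.2
  have hTmono : Monotone T := fun m n hmn a ha =>
    ⟨ha.1, ha.2.1.trans (by exact_mod_cast hmn), ha.2.2⟩
  have hUmono : Monotone U := fun m n hmn => biUnion_subset_biUnion_left (hTmono hmn)
  have hUeq : {x | t < ballMaximalFunction μ f x} = ⋃ n, U n := by
    ext x
    simp only [mem_ofPred_eq, lt_ballMaximalFunction_iff, U, T, mem_iUnion, exists_prop]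
    constructor
    · rintro ⟨z, r, hx, hr⟩
      obtain ⟨n, hn⟩ := exists_nat_ge r
      exact ⟨n, (z, r), ⟨pos_of_mem_ball hx, hn, hr⟩, hx⟩
    · rintro ⟨n, a, ⟨_, _, h⟩, hx⟩
      exact ⟨a.1, a.2, hx, h⟩
  rw [hUeq, hUmono.measure_iUnion, ENNReal.mul_iSup]
  refine iSup_le fun n => ?_
  obtain ⟨v, hvT, hdisj, hcov⟩ := Vitali.exists_disjoint_subfamily_covering_enlargement
    (fun a : X × ℝ => ball a.1 a.2) (T n) (fun a => a.2) 2 one_lt_two (fun a ha => ha.1.le) n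
    (fun a ha => ha.2.1) (fun a ha => nonempty_ball.2 ha.1)
  have hvc : v.Countable := by
    have h1 := Measure.countable_meas_pos_of_disjoint_iUnion (μ := μ)
      (As := fun a : v => ball a.1.1 a.1.2) (fun _ => measurableSet_ball)
      (fun a b hab => hdisj a.2 b.2 (fun h => hab (Subtype.ext h)))
    have h2 : {a : v | 0 < μ (ball a.1.1 a.1.2)} = univ :=
      eq_univ_of_forall fun a => hμ.ball_pos _ _ (hvT a.2).1
    rw [h2, countable_univ_iff] at h1
    exact countable_coe_iff.1 h1
  -- A selected ball meets the given one and has at least half its radius, so enlarging it 5 times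
  -- suffices; `8 = 2 ^ 3` costs three doublings.
  have hsub : U n ⊆ ⋃ a ∈ v, ball a.1 (2 ^ 3 * a.2) := by
    refine iUnion₂_subset fun a ha x hx => ?_
    obtain ⟨b, hb, ⟨y, hya, hyb⟩, hab⟩ := hcov a ha
    refine mem_biUnion hb ?_
    have hb0 := (hvT hb).1
    simp only [mem_ball] at *
    have h1 := dist_triangle4_right x b.1 a.1 y
    have h2 := dist_triangle x a.1 y
    have h3 := dist_triangle x y b.1
    rw [dist_comm a.1 y] at h2
    linarith
  have hball : ∀ a ∈ v, t * μ (ball a.1 a.2) ≤ ∫⁻ y in ball a.1 a.2, f y ∂μ := by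
    intro a ha
    have h := (hvT ha).2.2.le
    rw [setLAverage_eq] at h
    exact (ENNReal.le_div_iff_mul_le (Or.inl (hμ.ball_pos _ _ (hvT ha).1).ne')
      (Or.inl (hμ.ball_lt_top _ _ (hvT ha).1).ne)).1 h
  have := hvc.to_subtype
  calc t * μ (U n) ≤ t * ∑' a : v, μ (ball a.1.1 (2 ^ 3 * a.1.2)) := by
        gcongr
        exact (measure_mono hsub).trans (measure_biUnion_le μ hvc _)
    _ ≤ t * ∑' a : v, cμ ^ 3 * μ (ball a.1.1 a.1.2) := by
        gcongr with a
        exact hμ.measure_ball_two_pow_mul_le _ (hvT a.2).1 3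
    _ = cμ ^ 3 * ∑' a : v, t * μ (ball a.1.1 a.1.2) := by
        rw [ENNReal.tsum_mul_left, ENNReal.tsum_mul_left]; ring
    _ ≤ cμ ^ 3 * ∑' a : v, ∫⁻ y in ball a.1.1 a.1.2, f y ∂μ := by
        gcongr with a; exact hball a.1 a.2
    _ = cμ ^ 3 * ∫⁻ y in ⋃ a ∈ v, ball a.1 a.2, f y ∂μ := by
        rw [lintegral_biUnion hvc (fun _ _ => measurableSet_ball) hdisj]
    _ ≤ _ := by gcongr; exact Measure.restrict_le_self

/-- The part of `f` below `t` contributes at most `t` to each average. -/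
theorem ballMaximalFunction_le_add_half [BorelSpace X] (hμ : IsDoublingMeasure μ cμ)
    (t : ℝ≥0∞) (x : X) :
    ballMaximalFunction μ f x ≤ ballMaximalFunction μ ({y | t < f y}.indicator f) x + t := by
  refine iSup_le fun z => iSup_le fun r => iSup_le fun hr => iSup_le fun hx => ?_
  have h0 := (hμ.ball_pos z r hr).ne'
  have h1 := (hμ.ball_lt_top z r hr).ne
  refine le_trans ?_ (add_le_add_left (setLAverage_ball_le_ballMaximalFunction hx) t)
  rw [setLAverage_eq, setLAverage_eq]
  calc (∫⁻ y in ball z r, f y ∂μ) / μ (ball z r)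
      ≤ (∫⁻ y in ball z r, ({y | t < f y}.indicator f y + t) ∂μ) / μ (ball z r) := by
        gcongr with y
        by_cases hy : t < f y
        · simp [hy]
        · simpa [hy] using not_lt.1 hy
    _ = _ := by
        rw [lintegral_add_right _ measurable_const, ENNReal.add_div]
        congr 1
        simp only [lintegral_const, Measure.restrict_apply_univ]
        exact ENNReal.mul_div_cancel_right h0 h1

/-- The weak type estimate at level `t / 2`, applied to the part of `f` above `t / 2`: the
truncation step of Marcinkiewicz interpolation. -/
theorem mul_measure_lt_ballMaximalFunction_le_setLIntegral [BorelSpace X]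
    (hμ : IsDoublingMeasure μ cμ) (hf : Measurable f) (t : ℝ≥0∞) :
    t * μ {x | t < ballMaximalFunction μ f x} ≤ 2 * cμ ^ 3 * ∫⁻ x in {x | t / 2 < f x}, f x ∂μ := by
  have hsub : {x | t < ballMaximalFunction μ f x} ⊆
      {x | t / 2 < ballMaximalFunction μ ({y | t / 2 < f y}.indicator f) x} := by
    intro x hx
    simp only [mem_ofPred_eq] at hx ⊢
    by_contra h
    have := hx.trans_le (ballMaximalFunction_le_add_half hμ (t / 2) x)
    refine absurd (this.trans_le (add_le_add_left (not_lt.1 h) _)) ?_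
    rw [ENNReal.add_halves]; exact lt_irrefl _
  have h := mul_measure_lt_ballMaximalFunction_le (f := {y | t / 2 < f y}.indicator f) hμ (t / 2)
  rw [lintegral_indicator (measurableSet_lt measurable_const hf)] at h
  calc _ ≤ t * μ {x | t / 2 < ballMaximalFunction μ ({y | t / 2 < f y}.indicator f) x} := by
        gcongr
    _ = 2 * (t / 2 * μ {x | t / 2 < ballMaximalFunction μ ({y | t / 2 < f y}.indicator f) x}) := by
        rw [← mul_assoc, ENNReal.mul_div_cancel (by simp) (by simp)]
    _ ≤ _ := by rw [mul_assoc]; gcongr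

end MaximalFunction

/-- The inner integral, over levels `t < 2 b`, in the strong type estimate. The condition `1 < s`
makes `t^(s-2)` integrable at `0`. -/
theorem mul_setLIntegral_rpow_le {s : ℝ} (hs : 1 < s) (b : ℝ≥0∞) :
    b * ∫⁻ t in {t : ℝ | 0 < t ∧ ENNReal.ofReal t / 2 < b}, ENNReal.ofReal (t ^ (s - 2)) ≤
      ENNReal.ofReal (2 ^ (s - 1) / (s - 1)) * b ^ s := by
  have hs1 : 0 < s - 1 := by linarith
  have hc : (0 : ℝ) < 2 ^ (s - 1) / (s - 1) := by positivity
  by_cases hb : b = ∞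
  · rw [hb, ENNReal.top_rpow_of_pos (by linarith), ENNReal.mul_top (by simpa using hc)]
    exact le_top
  lift b to ℝ≥0 using hb
  have hb0 : (0 : ℝ) ≤ b := b.coe_nonneg
  have hset : {t : ℝ | 0 < t ∧ ENNReal.ofReal t / 2 < b} ⊆ Ioc 0 (2 * (b : ℝ)) := by
    rintro t ⟨h1, h2⟩
    refine ⟨h1, ?_⟩
    rw [ENNReal.div_lt_iff (by simp) (by simp)] at h2
    have := h2.le
    rw [← ENNReal.ofReal_coe_nnreal, ← ENNReal.ofReal_ofNat, ← ENNReal.ofReal_mul (by positivity),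
      ENNReal.ofReal_le_ofReal_iff (by positivity)] at this
    linarith
  have hint : IntervalIntegrable (fun t : ℝ => t ^ (s - 2)) volume 0 (2 * b) :=
    intervalIntegral.intervalIntegrable_rpow' (by linarith)
  have hval : ∫⁻ t in Ioc 0 (2 * (b : ℝ)), ENNReal.ofReal (t ^ (s - 2)) =
      ENNReal.ofReal ((2 * b) ^ (s - 1) / (s - 1)) := by
    rw [← ofReal_integral_eq_lintegral_ofReal
      ((intervalIntegrable_iff_integrableOn_Ioc_of_le (by positivity)).1 hint)
      ((ae_restrict_iff' measurableSet_Ioc).2 (.of_forall fun t ht => Real.rpow_nonneg ht.1.le _)),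
      ← intervalIntegral.integral_of_le (by positivity), integral_rpow (Or.inl (by linarith))]
    rw [show s - 2 + 1 = s - 1 by ring, Real.zero_rpow hs1.ne', sub_zero]
  calc _ ≤ (b : ℝ≥0∞) * ∫⁻ t in Ioc 0 (2 * (b : ℝ)), ENNReal.ofReal (t ^ (s - 2)) := by
        gcongr
    _ = ENNReal.ofReal (b * ((2 * b) ^ (s - 1) / (s - 1))) := by
        rw [hval, ENNReal.ofReal_mul hb0, ENNReal.ofReal_coe_nnreal]
    _ = ENNReal.ofReal (2 ^ (s - 1) / (s - 1) * (b : ℝ) ^ s) := by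
        congr 1
        rw [Real.mul_rpow (by norm_num) hb0]
        rcases hb0.eq_or_lt with h | h
        · rw [show (b : ℝ) = 0 from h.symm, Real.zero_rpow (by linarith : s ≠ 0),
            zero_mul, mul_zero]
        · rw [Real.rpow_sub_one h.ne' s]
          field_simp
    _ = _ := by
        rw [ENNReal.ofReal_mul hc.le, ← ENNReal.ofReal_rpow_of_nonneg hb0 (by linarith)]
        simp

/-- Layer cake estimate for functions with values in `[0, ∞]`. -/
theorem lintegral_rpow_le_lintegral_meas_lt {α : Type*} [MeasurableSpace α] {μ : Measure α}
    {h : α → ℝ≥0∞} (hh : Measurable h) {s : ℝ} (hs : 0 < s) :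
    ∫⁻ x, h x ^ s ∂μ ≤ ENNReal.ofReal s *
      ∫⁻ t in Ioi (0 : ℝ), μ {x | ENNReal.ofReal t < h x} * ENNReal.ofReal (t ^ (s - 1)) := by
  -- The layer cake formula is applied to the finite truncations `min h n`, and monotone convergence
  -- does the rest.
  have hmono : Monotone fun (n : ℕ) (x : α) => min (h x) n ^ s := by
    intro m n hmn x
    dsimp only
    gcongr
  have hsup : ∀ x, h x ^ s = ⨆ n : ℕ, min (h x) (n : ℝ≥0∞) ^ s := by
    intro x
    refine le_antisymm ?_ (iSup_le fun n => by gcongr; exact min_le_left _ _)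
    have hlim : Filter.Tendsto (fun n : ℕ => min (h x) (n : ℝ≥0∞) ^ s) Filter.atTop
        (nhds (min (h x) ∞ ^ s)) :=
      (tendsto_const_nhds.min ENNReal.tendsto_nat_nhds_top).ennrpow_const s
    rw [min_top_right] at hlim
    exact le_of_tendsto' hlim fun n => le_iSup (fun n : ℕ => min (h x) (n : ℝ≥0∞) ^ s) n
  simp_rw [hsup]
  rw [lintegral_iSup (fun n => (hh.min measurable_const).pow_const s) hmono]
  refine iSup_le fun n => ?_
  have hfin : ∀ x, min (h x) (n : ℝ≥0∞) ≠ ∞ := fun x =>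
    ne_top_of_le_ne_top (ENNReal.natCast_ne_top n) (min_le_right _ _)
  have h1 := lintegral_rpow_eq_lintegral_meas_lt_mul μ
    (f := fun x => (min (h x) (n : ℝ≥0∞)).toReal) (.of_forall fun x => ENNReal.toReal_nonneg)
    (hh.min measurable_const).ennreal_toReal.aemeasurable hs
  have h2 : ∀ x, ENNReal.ofReal ((min (h x) (n : ℝ≥0∞)).toReal ^ s) = min (h x) (n : ℝ≥0∞) ^ s := by
    intro x
    rw [← ENNReal.ofReal_rpow_of_nonneg ENNReal.toReal_nonneg hs.le, ENNReal.ofReal_toReal (hfin x)]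
  simp_rw [h2] at h1
  rw [h1]
  gcongr 1
  refine setLIntegral_mono' measurableSet_Ioi fun t ht => ?_
  gcongr 2
  intro x hx
  rw [mem_ofPred_eq] at hx ⊢
  exact ((ENNReal.ofReal_lt_iff_lt_toReal (mem_Ioi.1 ht).le (hfin _)).2 hx).trans_le
    (min_le_left _ _)

/-- The strong type `(s, s)` estimate for the maximal function. -/
theorem lintegral_ballMaximalFunction_rpow_le [BorelSpace X] {μ : Measure X} {cμ : ℝ≥0}
    (hμ : IsDoublingMeasure μ cμ) {f : X → ℝ≥0∞} (hf : Measurable f) {s : ℝ} (hs : 1 < s) :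
    ∫⁻ x, ballMaximalFunction μ f x ^ s ∂μ ≤
      ENNReal.ofReal s * (2 * cμ ^ 3 * ENNReal.ofReal (2 ^ (s - 1) / (s - 1))) *
        ∫⁻ x, f x ^ s ∂μ := by
  have := hμ.sigmaFinite
  have hs0 : 0 < s := by linarith
  have hmeas : MeasurableSet {a : ℝ × X | 0 < a.1 ∧ ENNReal.ofReal a.1 / 2 < f a.2} := by
    refine MeasurableSet.inter (s₁ := {a : ℝ × X | 0 < a.1})
      (s₂ := {a : ℝ × X | ENNReal.ofReal a.1 / 2 < f a.2})
      (measurableSet_lt measurable_const measurable_fst) (measurableSet_lt ?_ ?_)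
    · exact (ENNReal.measurable_ofReal.comp measurable_fst).div_const 2
    · exact hf.comp measurable_snd
  have hFm : Measurable fun a : ℝ × X =>
      {a : ℝ × X | 0 < a.1 ∧ ENNReal.ofReal a.1 / 2 < f a.2}.indicator
        (fun a => f a.2 * ENNReal.ofReal (a.1 ^ (s - 2))) a := by
    refine Measurable.indicator ?_ hmeas
    fun_prop
  calc ∫⁻ x, ballMaximalFunction μ f x ^ s ∂μ
      ≤ ENNReal.ofReal s * ∫⁻ t in Ioi (0 : ℝ),
          μ {x | ENNReal.ofReal t < ballMaximalFunction μ f x} * ENNReal.ofReal (t ^ (s - 1)) :=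
        lintegral_rpow_le_lintegral_meas_lt measurable_ballMaximalFunction hs0
    _ ≤ ENNReal.ofReal s * ∫⁻ t in Ioi (0 : ℝ), 2 * cμ ^ 3 *
          ∫⁻ x, {a : ℝ × X | 0 < a.1 ∧ ENNReal.ofReal a.1 / 2 < f a.2}.indicator
            (fun a => f a.2 * ENNReal.ofReal (a.1 ^ (s - 2))) (t, x) ∂μ := by
        gcongr 1
        refine setLIntegral_mono' measurableSet_Ioi fun t ht => ?_
        have ht : 0 < t := ht
        have h1 := mul_measure_lt_ballMaximalFunction_le_setLIntegral hμ hf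
          (ENNReal.ofReal t)
        -- One factor `t` is split off to be absorbed by the truncated weak type estimate; Tonelli
        -- then lets `t` be integrated first.
        have h2 : ENNReal.ofReal (t ^ (s - 1)) = ENNReal.ofReal t * ENNReal.ofReal (t ^ (s - 2)) := by
          rw [← ENNReal.ofReal_mul ht.le]
          congr 1
          rw [show s - 1 = 1 + (s - 2) by ring, Real.rpow_add ht, Real.rpow_one]
        have hm : MeasurableSet {x | ENNReal.ofReal t / 2 < f x} :=
          measurableSet_lt measurable_const hf
        calc _ = ENNReal.ofReal t * μ {x | ENNReal.ofReal t < ballMaximalFunction μ f x} *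
              ENNReal.ofReal (t ^ (s - 2)) := by rw [h2]; ring
          _ ≤ 2 * cμ ^ 3 * (∫⁻ x in {x | ENNReal.ofReal t / 2 < f x}, f x ∂μ) *
              ENNReal.ofReal (t ^ (s - 2)) := by gcongr
          _ = _ := by
              rw [mul_assoc, ← lintegral_mul_const' _ _ ENNReal.ofReal_ne_top,
                ← lintegral_indicator hm]
              congr 2 with x
              simp only [indicator, mem_ofPred_eq, ht, true_and]
    _ = ENNReal.ofReal s * (2 * cμ ^ 3 * ∫⁻ x, ∫⁻ t in Ioi (0 : ℝ),
          {a : ℝ × X | 0 < a.1 ∧ ENNReal.ofReal a.1 / 2 < f a.2}.indicator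
            (fun a => f a.2 * ENNReal.ofReal (a.1 ^ (s - 2))) (t, x) ∂volume ∂μ) := by
        rw [lintegral_const_mul' _ _ (ENNReal.mul_ne_top (by simp)
          (ENNReal.pow_ne_top ENNReal.coe_ne_top)), lintegral_lintegral_swap hFm.aemeasurable]
    _ ≤ ENNReal.ofReal s * (2 * cμ ^ 3 * ∫⁻ x,
          ENNReal.ofReal (2 ^ (s - 1) / (s - 1)) * f x ^ s ∂μ) := by
        gcongr with x
        refine le_trans ?_ (mul_setLIntegral_rpow_le hs (f x))
        have hm : MeasurableSet {t : ℝ | 0 < t ∧ ENNReal.ofReal t / 2 < f x} :=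
          (measurable_prodMk_right (y := x)) hmeas
        rw [← lintegral_const_mul _ (by fun_prop), ← lintegral_indicator hm]
        exact setLIntegral_le_lintegral _ _
    _ = _ := by
        rw [lintegral_const_mul' _ _ ENNReal.ofReal_ne_top]; ring

/-! ### From mean oscillation to pointwise estimates. -/

theorem edist_setAverage_le {α : Type*} [MeasurableSpace α] {μ : Measure α} {u : α → ℝ}
    {s : Set α} (h0 : μ s ≠ 0) (h1 : μ s ≠ ∞) (hu : IntegrableOn u s μ)
    (c : ℝ) : edist (⨍ y in s, u y ∂μ) c ≤ ⨍⁻ y in s, edist (u y) c ∂μ := by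
  have : NeZero (μ.restrict s) := ⟨by rwa [Ne, Measure.restrict_eq_zero]⟩
  have : IsFiniteMeasure (μ.restrict s) := ⟨by
    rw [Measure.restrict_apply_univ]; exact h1.lt_top⟩
  have hint : Integrable u ((μ.restrict s univ)⁻¹ • μ.restrict s) := hu.to_average
  have h2 : (⨍ y in s, u y ∂μ) - c = ∫ y, (u y - c) ∂((μ.restrict s univ)⁻¹ • μ.restrict s) := by
    rw [integral_sub hint (integrable_const c), integral_const]
    rw [probReal_univ, one_smul]; rfl
  rw [edist_eq_enorm_sub, h2]
  simp_rw [edist_eq_enorm_sub]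
  exact enorm_integral_le_lintegral_enorm _

theorem edist_setAverage_le_of_subset {α : Type*} [MeasurableSpace α] {μ : Measure α}
    {u : α → ℝ} {s t : Set α} {K : ℝ≥0∞} (hst : s ⊆ t) (h0 : μ s ≠ 0)
    (h1 : μ t ≠ ∞) (hK : μ t ≤ K * μ s) (hu : IntegrableOn u s μ) (c : ℝ) :
    edist (⨍ y in s, u y ∂μ) c ≤ K * ⨍⁻ y in t, edist (u y) c ∂μ := by
  have hs1 : μ s ≠ ∞ := ne_top_of_le_ne_top h1 (measure_mono hst)
  have ht0 : μ t ≠ 0 := fun h => h0 (measure_mono_null hst h)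
  refine (edist_setAverage_le h0 hs1 hu c).trans ?_
  rw [setLAverage_eq, setLAverage_eq, ENNReal.div_le_iff h0 hs1]
  calc ∫⁻ y in s, edist (u y) c ∂μ ≤ ∫⁻ y in t, edist (u y) c ∂μ := lintegral_mono_set hst
    _ = (∫⁻ y in t, edist (u y) c ∂μ) / μ t * μ t := (ENNReal.div_mul_cancel ht0 h1).symm
    _ ≤ (∫⁻ y in t, edist (u y) c ∂μ) / μ t * (K * μ s) := by gcongr
    _ = _ := by ring

section Telescoping

variable {μ : Measure X} {cμ : ℝ≥0} {u : X → ℝ} {L : ℝ≥0}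

variable [BorelSpace X]

theorem LipschitzWith.integrableOn_ball (hμ : IsDoublingMeasure μ cμ) (hu : LipschitzWith L u)
    (x : X) {r : ℝ} (hr : 0 < r) : IntegrableOn u (ball x r) μ := by
  refine Measure.integrableOn_of_bounded (M := ‖u x‖ + L * r) (hμ.ball_lt_top x r hr).ne
    hu.continuous.measurable.aestronglyMeasurable ?_
  refine (ae_restrict_iff' measurableSet_ball).2 (.of_forall fun y hy => ?_)
  have h1 := hu.dist_le_mul y x
  have h2 : (L : ℝ) * dist y x ≤ L * r := by gcongr; exact (mem_ball.1 hy).le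
  rw [dist_eq_norm] at h1
  have h3 := norm_le_norm_add_norm_sub' (u y) (u x)
  linarith

/-- Makes averages over shrinking balls converge to `u x` at every point, so telescoping needs no
exceptional set. -/
theorem edist_setAverage_ball_le (hμ : IsDoublingMeasure μ cμ) (hu : LipschitzWith L u) (x : X)
    {r : ℝ} (hr : 0 < r) : edist (⨍ y in ball x r, u y ∂μ) (u x) ≤ L * ENNReal.ofReal r := by
  have h0 := (hμ.ball_pos x r hr).ne'
  have h1 := (hμ.ball_lt_top x r hr).ne
  refine (edist_setAverage_le h0 h1 (hu.integrableOn_ball hμ x hr) _).trans ?_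
  rw [setLAverage_eq, ENNReal.div_le_iff h0 h1, ← setLIntegral_const]
  refine setLIntegral_mono' measurableSet_ball fun y hy => (hu y x).trans ?_
  gcongr
  rw [edist_dist]
  exact ENNReal.ofReal_le_ofReal (mem_ball.1 hy).le

/-- Telescoping over the balls `B(x, R / 2 ^ n)`. -/
theorem edist_setAverage_ball_le_of_oscillation (hμ : IsDoublingMeasure μ cμ)
    (hu : LipschitzWith L u) {x : X} {a : ℝ≥0∞}
    (hosc : ∀ r : ℝ, 0 < r → ⨍⁻ y in ball x r, edist (u y) (⨍ z in ball x r, u z ∂μ) ∂μ ≤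
      ENNReal.ofReal r * a) {R : ℝ} (hR : 0 < R) :
    edist (⨍ y in ball x R, u y ∂μ) (u x) ≤ 2 * (cμ * (ENNReal.ofReal R * a)) := by
  have hpos : ∀ n : ℕ, 0 < R / 2 ^ n := fun n => by positivity
  have hofReal : ∀ n : ℕ, ENNReal.ofReal (R / 2 ^ n) = ENNReal.ofReal R / 2 ^ n := fun n => by
    rw [ENNReal.ofReal_div_of_pos (by positivity), ENNReal.ofReal_pow (by norm_num)]
    simp
  have hstep : ∀ n : ℕ, edist (⨍ y in ball x (R / 2 ^ n), u y ∂μ)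
      (⨍ y in ball x (R / 2 ^ (n + 1)), u y ∂μ) ≤ cμ * (ENNReal.ofReal R * a) / 2 ^ n := by
    intro n
    have h2 : 2 * (R / 2 ^ (n + 1)) = R / 2 ^ n := by rw [pow_succ]; field_simp
    have hdbl := hμ.doubling x _ (hpos (n + 1))
    rw [h2] at hdbl
    rw [edist_comm]
    refine (edist_setAverage_le_of_subset (ball_subset_ball ?_) (hμ.ball_pos x _ (hpos _)).ne'
      (hμ.ball_lt_top x _ (hpos n)).ne hdbl (hu.integrableOn_ball hμ x (hpos _)) _).trans ?_
    · linarith [hpos (n + 1)]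
    · calc _ ≤ (cμ : ℝ≥0∞) * (ENNReal.ofReal (R / 2 ^ n) * a) := by
            gcongr; exact hosc _ (hpos n)
        _ = _ := by rw [hofReal]; simp only [div_eq_mul_inv]; ring
  have hlim : Filter.Tendsto (fun n : ℕ => ⨍ y in ball x (R / 2 ^ n), u y ∂μ) Filter.atTop
      (nhds (u x)) := by
    rw [tendsto_iff_edist_tendsto_0]
    have h0 : Filter.Tendsto (fun n : ℕ => L * ENNReal.ofReal (R / 2 ^ n)) Filter.atTop
        (nhds (L * ENNReal.ofReal 0)) := by
      refine ENNReal.Tendsto.const_mul (ENNReal.tendsto_ofReal ?_) (Or.inr ENNReal.coe_ne_top)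
      have := (tendsto_pow_atTop_nhds_zero_of_lt_one (r := (1 / 2 : ℝ)) (by norm_num)
        (by norm_num)).const_mul R
      simpa [div_eq_mul_inv] using this
    rw [ENNReal.ofReal_zero, mul_zero] at h0
    exact tendsto_of_tendsto_of_tendsto_of_le_of_le tendsto_const_nhds h0 (fun _ => zero_le)
      (fun n => edist_setAverage_ball_le hμ hu x (hpos n))
  simpa using edist_le_of_edist_le_geometric_two_of_tendsto₀ _ hstep hlim

/-- With `d = dist x y`, chain `u x`, the average over `B(x,2d)`, the average over `B(y,d)`, and `u
y`. The middle step costs `cμ ^ 2` since `B(x,2d) ⊆ B(y,4d)`. -/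
theorem edist_le_of_oscillation (hμ : IsDoublingMeasure μ cμ) (hu : LipschitzWith L u)
    {a : X → ℝ≥0∞}
    (hosc : ∀ (x : X) (r : ℝ), 0 < r →
      ⨍⁻ y in ball x r, edist (u y) (⨍ z in ball x r, u z ∂μ) ∂μ ≤ ENNReal.ofReal r * a x)
    (x y : X) : edist (u x) (u y) ≤ edist x y * (6 * cμ ^ 2 * a x + 6 * cμ ^ 2 * a y) := by
  rcases eq_or_ne x y with rfl | hxy
  · simp
  have hd : 0 < dist x y := dist_pos.2 hxy
  have hd2 : 0 < 2 * dist x y := by positivity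
  have hc : (1 : ℝ≥0∞) ≤ cμ := by exact_mod_cast hμ.one_lt.le
  have hc2 : (cμ : ℝ≥0∞) ≤ cμ ^ 2 := by simpa using pow_le_pow_right₀ hc (show 1 ≤ 2 by norm_num)
  have h2 : ENNReal.ofReal (2 * dist x y) = 2 * edist x y := by
    rw [ENNReal.ofReal_mul (by norm_num), ← edist_dist]; simp
  have e1 := edist_setAverage_ball_le_of_oscillation hμ hu (hosc x) hd2
  have e3 := edist_setAverage_ball_le_of_oscillation hμ hu (hosc y) hd
  rw [h2] at e1
  rw [← edist_dist] at e3
  have hsub : ball y (dist x y) ⊆ ball x (2 * dist x y) := by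
    refine ball_subset_ball' ?_
    rw [dist_comm y x]; linarith
  have hmeas : μ (ball x (2 * dist x y)) ≤ cμ ^ 2 * μ (ball y (dist x y)) := by
    refine (measure_mono (ball_subset_ball' ?_)).trans
      (hμ.measure_ball_two_pow_mul_le y hd 2)
    linarith
  have e2 : edist (⨍ z in ball y (dist x y), u z ∂μ) (⨍ z in ball x (2 * dist x y), u z ∂μ) ≤
      cμ ^ 2 * (2 * edist x y * a x) := by
    refine (edist_setAverage_le_of_subset hsub (hμ.ball_pos y _ hd).ne'
      (hμ.ball_lt_top x _ hd2).ne hmeas (hu.integrableOn_ball hμ y hd) _).trans ?_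
    gcongr
    rw [← h2]
    exact hosc x _ hd2
  rw [edist_comm] at e1 e2
  calc edist (u x) (u y) ≤ _ := edist_triangle4 _ (⨍ z in ball x (2 * dist x y), u z ∂μ)
        (⨍ z in ball y (dist x y), u z ∂μ) _
    _ ≤ 2 * (cμ * (2 * edist x y * a x)) + cμ ^ 2 * (2 * edist x y * a x) +
        2 * (cμ * (edist x y * a y)) := by gcongr
    -- Since `cμ ≤ cμ ^ 2`, the terms at `x` add up to `4 + 2 = 6`; at `y` the factor `2` is raised
    -- to `6` for symmetry.
    _ ≤ 2 * (cμ ^ 2 * (2 * edist x y * a x)) + cμ ^ 2 * (2 * edist x y * a x) +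
        6 * (cμ ^ 2 * (edist x y * a y)) := by gcongr; norm_num
    _ = _ := by ring

/-- Under a Poincaré inequality, the maximal function of a weak upper gradient yields a Hajłasz
gradient. -/
theorem SupportsPoincare.isHajlaszGradient (hμ : IsDoublingMeasure μ cμ) {q : ℝ} (hq : 0 < q)
    {CP : ℝ≥0} {lam : ℝ} (hP : SupportsPoincare μ q CP lam) (hu : LipschitzWith L u)
    {g : X → ℝ≥0∞} (hg : IsWeakUpperGradient q μ u g) {G : X → ℝ≥0∞} (hG : g =ᵐ[μ] G) :
    IsHajlaszGradient 1 μ u fun x =>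
      6 * cμ ^ 2 * (2 * CP * ballMaximalFunction μ (fun y => G y ^ q) x ^ (1 / q)) := by
  refine ⟨?_, ∅, measure_empty, fun x _ y _ => ?_⟩
  · have := measurable_ballMaximalFunction (μ := μ) (f := fun y => G y ^ q)
    exact (((this.pow_const _).const_mul _).const_mul _).aemeasurable
  rw [NNReal.coe_one, ENNReal.rpow_one]
  refine edist_le_of_oscillation hμ hu
    (a := fun x => 2 * CP * ballMaximalFunction μ (fun y => G y ^ q) x ^ (1 / q))
    (fun x r hr => ?_) x y
  refine (hP.2.2 x r hr u hu.continuous.measurable.aemeasurable g hg).trans ?_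
  have hdiam : ENNReal.ofReal (diam (ball x r)) ≤ 2 * ENNReal.ofReal r := by
    rw [← ENNReal.ofReal_ofNat, ← ENNReal.ofReal_mul (by norm_num)]
    exact ENNReal.ofReal_le_ofReal (diam_ball hr.le)
  -- The dilated ball also contains `x`, so the maximal function at `x` controls its average
  -- whatever `lam` is.
  have hmax : ⨍⁻ y in ball x (lam * r), g y ^ q ∂μ ≤ ballMaximalFunction μ (fun y => G y ^ q) x := by
    have hae : (fun y => g y ^ q) =ᵐ[μ.restrict (ball x (lam * r))] fun y => G y ^ q :=
      ae_restrict_of_ae (hG.mono fun y hy => by simp only [hy])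
    rw [laverage_congr hae]
    exact setLAverage_ball_le_ballMaximalFunction
      (mem_ball_self (mul_pos (one_pos.trans_le hP.2.1) hr))
  calc _ ≤ CP * (2 * ENNReal.ofReal r) *
        ballMaximalFunction μ (fun y => G y ^ q) x ^ (1 / q) := by gcongr
    _ = _ := by ring

end Telescoping

/-! ### Comparison of the capacities. -/

/-- The constant in the comparison of the capacities under a `q`-Poincaré inequality. -/
noncomputable def capacityConstant (p q : ℝ) (CP cμ : ℝ≥0) : ℝ≥0∞ :=
  (6 * cμ ^ 2 * (2 * CP)) ^ p * (ENNReal.ofReal (p / q) *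
    (2 * cμ ^ 3 * ENNReal.ofReal (2 ^ (p / q - 1) / (p / q - 1)))) + 1

theorem capacityConstant_ne_top {p : ℝ} (hp : 0 ≤ p) (q : ℝ) (CP cμ : ℝ≥0) :
    capacityConstant p q CP cμ ≠ ∞ := by
  unfold capacityConstant
  have h1 : (6 * cμ ^ 2 * (2 * CP) : ℝ≥0∞) ≠ ∞ := by
    exact_mod_cast ENNReal.coe_ne_top (r := 6 * cμ ^ (2 : ℕ) * (2 * CP))
  have h2 : (2 * cμ ^ 3 : ℝ≥0∞) ≠ ∞ := by
    exact_mod_cast ENNReal.coe_ne_top (r := 2 * cμ ^ (3 : ℕ))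
  exact ENNReal.add_ne_top.2 ⟨ENNReal.mul_ne_top (ENNReal.rpow_ne_top_of_nonneg hp h1)
    (ENNReal.mul_ne_top ENNReal.ofReal_ne_top (ENNReal.mul_ne_top h2 ENNReal.ofReal_ne_top)),
    ENNReal.one_ne_top⟩

theorem hajlaszCapacity_le_variationalCapacity [BorelSpace X] {μ : Measure X} {cμ : ℝ≥0}
    (hμ : IsDoublingMeasure μ cμ) {p q : ℝ} (hq : 0 < q) (hqp : q < p) {CP : ℝ≥0} {lam : ℝ}
    (hP : SupportsPoincare μ q CP lam) {F Ω : Set X} (hΩ : IsOpen Ω) :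
    hajlaszCapacity μ 1 p F Ω ≤ capacityConstant p q CP cμ * variationalCapacity μ p F Ω := by
  have hp : 0 < p := hq.trans hqp
  -- The summand `1` in the constant ensures this, so that one may divide by it.
  have h0 : capacityConstant p q CP cμ ≠ 0 := by simp [capacityConstant]
  have h1 := capacityConstant_ne_top hp.le q CP cμ
  rw [mul_comm, ← ENNReal.div_le_iff_le_mul (Or.inl h0) (Or.inl h1)]
  refine le_iInf₂ fun u hu => le_iInf₂ fun g hg => ?_
  rw [ENNReal.div_le_iff_le_mul (Or.inl h0) (Or.inl h1), mul_comm]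
  obtain ⟨κ, hκ⟩ := hu.1
  have hg' : IsWeakUpperGradient q μ u (Ω.indicator g) :=
    (hg.indicator hΩ hu.2.2).mono_exponent hμ hq.le hqp.le
  obtain ⟨G, hGm, hG⟩ := hg'.1
  have hs : 1 < p / q := (one_lt_div hq).2 hqp
  refine (iInf₂_le_of_le u hu (iInf₂_le _
    (hP.isHajlaszGradient hμ hq (holderWith_one.1 hκ) hg' hG))).trans ?_
  -- The cutoff to `Ω` pays off here: the integral over `X` produced by the maximal theorem reduces
  -- to one over `Ω`.
  have hGp : ∫⁻ x, (G x ^ q) ^ (p / q) ∂μ = ∫⁻ x in Ω, g x ^ p ∂μ := by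
    rw [← lintegral_indicator hΩ.measurableSet]
    refine lintegral_congr_ae (hG.mono fun x hx => ?_)
    dsimp only
    rw [← ENNReal.rpow_mul, mul_div_cancel₀ _ hq.ne', ← hx]
    by_cases hxΩ : x ∈ Ω <;> simp [hxΩ, hp]
  calc ∫⁻ x, (6 * cμ ^ 2 * (2 * CP *
        ballMaximalFunction μ (fun y => G y ^ q) x ^ (1 / q))) ^ p ∂μ
      = (6 * cμ ^ 2 * (2 * CP)) ^ p *
        ∫⁻ x, ballMaximalFunction μ (fun y => G y ^ q) x ^ (p / q) ∂μ := by
        rw [← lintegral_const_mul _ (measurable_ballMaximalFunction.pow_const _)]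
        refine lintegral_congr fun x => ?_
        rw [← mul_assoc, ENNReal.mul_rpow_of_nonneg _ _ hp.le, ← ENNReal.rpow_mul]
        congr 2
        ring
    _ ≤ (6 * cμ ^ 2 * (2 * CP)) ^ p * (ENNReal.ofReal (p / q) *
          (2 * cμ ^ 3 * ENNReal.ofReal (2 ^ (p / q - 1) / (p / q - 1))) *
            ∫⁻ x, (G x ^ q) ^ (p / q) ∂μ) := by
        gcongr
        exact lintegral_ballMaximalFunction_rpow_le hμ (hGm.pow_const q) hs
    _ ≤ capacityConstant p q CP cμ * ∫⁻ x in Ω, g x ^ p ∂μ := by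
        rw [hGp, ← mul_assoc]
        gcongr
        exact le_self_add

theorem theoremt (p : ℝ) (hp : 1 < p) :
    (∀ (X : Type u) [MetricSpace X] [Nontrivial X] [MeasurableSpace X] [BorelSpace X]
        (μ : Measure X) (cμ : ℝ≥0), IsDoublingMeasure μ cμ →
        ∀ Ω F : Set X, IsOpen Ω → Bornology.IsBounded Ω → IsClosed F → F ⊆ Ω →
          variationalCapacity μ p F Ω ≤ 4 ^ p * hajlaszCapacity μ 1 p F Ω) ∧
    (∀ (q : ℝ) (CP cμ : ℝ≥0), 1 ≤ q → q < p →
      ∃ C : ℝ≥0,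
        ∀ (X : Type u) [MetricSpace X] [Nontrivial X] [MeasurableSpace X] [BorelSpace X]
          (μ : Measure X), IsDoublingMeasure μ cμ →
          ∀ lam : ℝ, SupportsPoincare μ q CP lam →
          ∀ Ω F : Set X, IsOpen Ω → Bornology.IsBounded Ω → IsClosed F → F ⊆ Ω →
            hajlaszCapacity μ 1 p F Ω ≤ C * variationalCapacity μ p F Ω) := by
  refine ⟨fun X _ _ _ _ μ _ _ Ω F _ _ _ _ =>
    variationalCapacity_le_hajlaszCapacity μ (by linarith) F Ω, fun q CP cμ hq hqp =>
    ⟨(capacityConstant p q CP cμ).toNNReal, fun X _ _ _ _ μ hμ lam hP Ω F hΩ _ _ _ => ?_⟩⟩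
  rw [ENNReal.coe_toNNReal (capacityConstant_ne_top (by linarith) q CP cμ)]
  exact hajlaszCapacity_le_variationalCapacity hμ (by linarith) hqp hP hΩ
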